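/- A field $E$ is called ample (or large) if every smooth curve over $E$ (i.e. every separated, geometrically integral $E$-scheme $C$ of finite type which is smooth of relative dimension $1$ over $E$) that has an $E$-rational point has infinitely many $E$-rational points. A function field of one variable $F|K$ is a finitely generated field extension of transcendence degree $1$; it has a rational place if there is a valuation ring $\mathcal{O}$ of $F$ with $K\subseteq\mathcal{O}$ such that the canonical map from $K$ to the residue field of $\mathcal{O}$ is an isomorphism. Let $E$ be an ample field and let $K\subseteq E$ be a subfield with $\mathrm{tr.deg}(E|K)\geq 1$ (possibly infinite). Then for every function field of one variable $F|K$ with a rational place there is a $K$-embedding of $F$ into $E$. -/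

import Mathlib

universe u v w

open CategoryTheory AlgebraicGeometry

/-- `f : C ⟶ Spec E` makes `C` a smooth curve over the field `E`: a separated, geometrically integral
scheme of finite type over `E` which is smooth of relative dimension one over `E`
(local finite type is part of smoothness). -/
structure IsSmoothCurve {E : Type u} [Field E] {C : Scheme.{u}} (f : C ⟶ Spec (.of E)) :
    Prop where
  isSeparated : IsSeparated f
  quasiCompact : QuasiCompact f
  geometricallyIntegral : GeometricallyIntegral f
  smooth : SmoothOfRelativeDimension 1 f

/-- The set `C(E)` of `E`-rational points of an `E`-scheme `f : C ⟶ Spec E`: the sections of the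
structure morphism. -/
def RationalPoint {E : Type u} [Field E] {C : Scheme.{u}} (f : C ⟶ Spec (.of E)) : Type u :=
  {s : Spec (.of E) ⟶ C // s ≫ f = 𝟙 (Spec (.of E))}

/-- A field `E` is ample (also called large) if every smooth curve over `E` which has an
`E`-rational point has infinitely many of them. -/
def IsAmple (E : Type u) [Field E] : Prop :=
  ∀ (C : Scheme.{u}) (f : C ⟶ Spec (.of E)),
    IsSmoothCurve f → Nonempty (RationalPoint f) → Infinite (RationalPoint f)

/-- `F|K` is a function field of one variable: a finitely generated field extension of
transcendence degree one. -/
structure IsFunctionFieldOneVar (K : Type u) (F : Type v) [Field K] [Field F] [Algebra K F] :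
    Prop where
  fg : (⊤ : IntermediateField K F).FG
  trdeg_eq_one : Algebra.trdeg K F = 1

/-- `F|K` has a rational place: there is a valuation ring `O` of `F` containing `K` such that the
canonical map from `K` to the residue field of `O` is an isomorphism. -/
def HasRationalPlace (K : Type u) (F : Type v) [Field K] [Field F] [Algebra K F] : Prop :=
  ∃ (O : ValuationSubring F) (h : ∀ a : K, algebraMap K F a ∈ O),
    Function.Bijective
      ((IsLocalRing.residue O).comp ((algebraMap K F).codRestrict O.toSubring h))

/-! Let `v` be the valuation of the rational place. Its residue field is `K`, and it has a
uniformizer `π` (`exists_uniformizer`), which is transcendental over `K`. Send `X` to `π`. Then `F`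
is finite over `K(X)`, and it is separable because `π` is a uniformizer at a place with residue
field `K` (`isSeparable`). Hence the integral closure of `K[X]` in `F` is étale over `K[X]` at the
centre of `v`. One localization of it, `S`, is étale over `K[X]` and has a `K`-point over `X = 0`
(`exists_etale`).

It remains to embed `S` into `E`. An étale `E[X]`-algebra with a rational point over `X = 0` can be
replaced by an étale subalgebra `A` of `E⟦X⟧`. Since `A ⊗ L` embeds into `L⟦X⟧`, `Spec A` is a
geometrically integral smooth curve. Ampleness gives it infinitely many rational points, of which
finitely many lie over `X = 0`, so some point has `X ≠ 0` (`IsAmple.exists_algHom_ne_zero`).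

A single such point might have an algebraic `X`-coordinate. So take `t ∈ E` transcendental over `K`
and apply this to the curve of pairs of points of `S` with `X`-coordinates `x` and `t * x`
(`IsAmple.exists_two_algHom`). If `x ≠ 0`, then `x` and `t * x` are not both algebraic over `K`. A
point with transcendental `X`-coordinate is injective on `S`, because `S` is a domain algebraic over
`K[X]`, and it extends to the fraction field `F`. -/

open Polynomial TensorProduct

/-! ### Étale `E[X]`-algebras as affine smooth curves. -/

/-- The affine line is standard smooth of relative dimension one. -/
instance Polynomial.isStandardSmoothOfRelativeDimension_one (R : Type u) [CommRing R] :
    Algebra.IsStandardSmoothOfRelativeDimension 1 R R[X] := by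
  let P : Algebra.SubmersivePresentation R (MvPolynomial PUnit.{1} R) PUnit.{1} PEmpty.{1} :=
    { toGenerators := Algebra.Generators.mvPolynomial R PUnit.{1}
      relation := PEmpty.elim
      span_range_relation_eq_ker := by
        rw [Algebra.Generators.ker_eq_ker_aeval_val]
        have : RingHom.ker (MvPolynomial.aeval (R := R)
            (Algebra.Generators.mvPolynomial R PUnit.{1}).val) = ⊥ := by
          rw [← RingHom.injective_iff_ker_eq_bot]
          intro x y h
          simpa using h
        rw [this, Set.range_eq_empty, Ideal.span_empty]
      map := PEmpty.elim
      map_inj := fun a ↦ a.elim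
      jacobian_isUnit := by
        rw [Algebra.PreSubmersivePresentation.jacobian_eq_jacobiMatrix_det, Matrix.det_isEmpty,
          map_one]
        exact isUnit_one }
  have : Algebra.IsStandardSmoothOfRelativeDimension 1 R (MvPolynomial PUnit.{1} R) :=
    P.isStandardSmoothOfRelativeDimension (by simp [Algebra.Presentation.dimension])
  exact .of_algEquiv 1 (MvPolynomial.uniqueAlgEquiv R PUnit.{1})

theorem isStandardSmoothOfRelativeDimension_one_of_etale (E A : Type u) [CommRing E] [CommRing A]
    [Algebra E A] [Algebra E[X] A] [IsScalarTower E E[X] A] [Algebra.Etale E[X] A] :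
    Algebra.IsStandardSmoothOfRelativeDimension 1 E A := by
  have : Algebra.IsStandardSmoothOfRelativeDimension 0 E[X] A :=
    Algebra.Etale.iff_isStandardSmoothOfRelativeDimension_zero.mp inferInstance
  exact Algebra.IsStandardSmoothOfRelativeDimension.trans 1 0 E E[X] A

theorem isSmoothCurve_Spec_map (E A : Type u) [Field E] [CommRing A]
    [Algebra E A] [Algebra E[X] A] [IsScalarTower E E[X] A] [Algebra.Etale E[X] A]
    (hA : ∀ (L : Type u) [Field L] [Algebra E L], IsDomain (A ⊗[E] L)) :
    IsSmoothCurve (Spec.map (CommRingCat.ofHom (algebraMap E A))) where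
  isSeparated := inferInstance
  quasiCompact := inferInstance
  geometricallyIntegral := by
    refine ⟨geometrically_iff_of_commRing.mpr fun L _ _ Y fst snd h ↦ ?_⟩
    have := hA L
    have : IsIntegral (Spec (.of (A ⊗[E] L))) := inferInstance
    let e : Y ≅ Spec (.of (A ⊗[E] L)) := h.isoPullback ≪≫ pullbackSpecIso E A L
    have : Nonempty Y := ⟨e.inv (Classical.arbitrary _)⟩
    exact isIntegral_of_isOpenImmersion e.hom
  smooth := by
    rw [HasRingHomProperty.Spec_iff (P := @SmoothOfRelativeDimension 1)]
    refine RingHom.locally_of (RingHom.isStandardSmoothOfRelativeDimension_respectsIso (n := 1)) _ ?_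
    rw [CommRingCat.hom_ofHom, RingHom.isStandardSmoothOfRelativeDimension_algebraMap]
    exact isStandardSmoothOfRelativeDimension_one_of_etale E A

/-- The rational points of an affine `E`-scheme are the `E`-algebra maps to `E`. -/
noncomputable def algHomEquivRationalPoint (E A : Type u) [Field E] [CommRing A] [Algebra E A] :
    (A →ₐ[E] E) ≃ RationalPoint (Spec.map (CommRingCat.ofHom (algebraMap E A))) where
  toFun φ := ⟨Spec.map (CommRingCat.ofHom φ.toRingHom), by
    rw [← Spec.map_comp, ← CommRingCat.ofHom_comp]
    have : φ.toRingHom.comp (algebraMap E A) = RingHom.id E := by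
      ext x; simp
    rw [this]
    simp⟩
  invFun s :=
    { (Spec.preimage s.1).hom with
      commutes' := fun r ↦ by
        have h : Spec.map (CommRingCat.ofHom (algebraMap E A) ≫ Spec.preimage s.1) =
            Spec.map (𝟙 (CommRingCat.of E)) := by
          rw [Spec.map_comp, Spec.map_preimage, Spec.map_id]
          exact s.2
        exact congr($(Spec.map_injective h).hom r) }
  left_inv φ := by ext x; simp
  right_inv s := by
    apply Subtype.ext
    simp

theorem IsAmple.infinite_algHom {E : Type u} [Field E] (hE : IsAmple E) (A : Type u) [CommRing A]
    [Algebra E A] [Algebra E[X] A] [IsScalarTower E E[X] A] [Algebra.Etale E[X] A]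
    (hA : ∀ (L : Type u) [Field L] [Algebra E L], IsDomain (A ⊗[E] L)) [h : Nonempty (A →ₐ[E] E)] :
    Infinite (A →ₐ[E] E) :=
  (algHomEquivRationalPoint E A).infinite_iff.mpr
    (hE _ _ (isSmoothCurve_Spec_map E A hA) (h.map (algHomEquivRationalPoint E A)))

/-! ### Power series: `X`-adic completeness and extension of scalars. -/

instance PowerSeries.isAdicComplete_span_X (R : Type*) [CommRing R] :
    IsAdicComplete (Ideal.span {(PowerSeries.X : PowerSeries R)}) (PowerSeries R) where
  haus' f hf := by
    ext n
    have h := hf (n + 1)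
    rw [SModEq.zero, smul_eq_mul, Ideal.mul_top, Ideal.span_singleton_pow,
      Ideal.mem_span_singleton, PowerSeries.X_pow_dvd_iff] at h
    simpa using h n n.lt_succ_self
  prec' f hf := by
    refine ⟨PowerSeries.mk fun n ↦ PowerSeries.coeff n (f (n + 1)), fun n ↦ ?_⟩
    rw [SModEq.sub_mem, smul_eq_mul, Ideal.mul_top, Ideal.span_singleton_pow,
      Ideal.mem_span_singleton, PowerSeries.X_pow_dvd_iff]
    intro m hm
    have h := hf (Nat.succ_le_of_lt hm)
    rw [SModEq.sub_mem, smul_eq_mul, Ideal.mul_top, Ideal.span_singleton_pow,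
      Ideal.mem_span_singleton, PowerSeries.X_pow_dvd_iff] at h
    have := h m m.lt_succ_self
    rw [map_sub, sub_eq_zero] at this ⊢
    rw [PowerSeries.coeff_mk, ← this]

section TensorPowerSeries

variable (E L : Type*) [Field E] [Field L] [Algebra E L]

/-- The canonical map `E⟦X⟧ ⊗ L → L⟦X⟧`. -/
noncomputable def PowerSeries.tensorToPowerSeries :
    PowerSeries E ⊗[E] L →ₐ[E] PowerSeries L :=
  Algebra.TensorProduct.lift (PowerSeries.mapAlgHom (Algebra.ofId E L))
    (IsScalarTower.toAlgHom E L (PowerSeries L)) fun _ _ ↦ .all _ _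

theorem PowerSeries.coeff_tensorToPowerSeries_tmul (f : PowerSeries E) (a : L) (n : ℕ) :
    PowerSeries.coeff n (tensorToPowerSeries E L (f ⊗ₜ a)) = PowerSeries.coeff n f • a := by
  simp only [tensorToPowerSeries, Algebra.TensorProduct.lift_tmul, IsScalarTower.coe_toAlgHom',
    PowerSeries.algebraMap_apply, Algebra.algebraMap_self, RingHom.id_apply,
    PowerSeries.coeff_mul_C, Algebra.smul_def]
  rfl

/-- An element of the tensor product is a finite sum of power series times vectors of an `E`-basis
of `L`; if its image vanishes, linear independence applies in each degree. -/
theorem PowerSeries.tensorToPowerSeries_injective :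
    Function.Injective (tensorToPowerSeries E L) := by
  classical
  rw [injective_iff_map_eq_zero]
  intro x hx
  let b := Module.Basis.ofVectorSpace E L
  let e := TensorProduct.equivFinsuppOfBasisRight (M := PowerSeries E) b
  obtain ⟨y, rfl⟩ := e.symm.surjective x
  have hy : y = 0 := by
    ext i n
    have h (n : ℕ) : ∑ i ∈ y.support, PowerSeries.coeff n (y i) • b i = 0 := by
      rw [show e.symm y = _ from TensorProduct.equivFinsuppOfBasisRight_symm_apply b y, Finsupp.sum, map_sum] at hx
      simpa [coeff_tensorToPowerSeries_tmul] using congr(PowerSeries.coeff n $hx)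
    by_cases hi : i ∈ y.support
    · simpa using linearIndependent_iff'.mp b.linearIndependent _ _ (h n) i hi
    · simp [Finsupp.notMem_support_iff.mp hi]
  simp [hy]

end TensorPowerSeries

/-- By flatness `A ⊗ L` embeds into `E⟦X⟧ ⊗ L`, hence into `L⟦X⟧`. This is the source of geometric
integrality. -/
theorem Subalgebra.isDomain_tensor_of_powerSeries {E : Type u} [Field E]
    (A : Subalgebra E[X] (PowerSeries E)) (L : Type*) [Field L] [Algebra E L] :
    IsDomain (A ⊗[E] L) := by
  let i : A →ₐ[E] PowerSeries E := A.val.restrictScalars E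
  have hi : Function.Injective (Algebra.TensorProduct.map i (.id E L)) :=
    Module.Flat.rTensor_preserves_injective_linearMap i.toLinearMap Subtype.val_injective
  exact ((PowerSeries.tensorToPowerSeries_injective E L).comp hi).isDomain
    ((PowerSeries.tensorToPowerSeries E L).comp
      (Algebra.TensorProduct.map i (.id E L))).toRingHom

/-! ### Étale `E[X]`-algebras near a rational point over `X = 0`. -/

/-- Such points factor through the fibre `E ⊗[E[X]] A` over `0`, which is unramified over the field
`E` and therefore finite-dimensional. -/
theorem Algebra.Etale.finite_algHom_X_eq_zero {E A : Type*} [Field E] [CommRing A]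
    [Algebra E A] [Algebra E[X] A] [IsScalarTower E E[X] A] [Algebra.Etale E[X] A] :
    Finite {φ : A →ₐ[E] E // φ (algebraMap E[X] A X) = 0} := by
  let : Algebra E[X] E := (evalRingHom 0).toAlgebra
  have hX (p : E[X]) : algebraMap E[X] E p = p.eval 0 := rfl
  have : IsScalarTower E E[X] E := .of_algebraMap_eq fun x ↦ by simp [hX]
  have : Module.Finite E (E ⊗[E[X]] A) := Algebra.FormallyUnramified.finite_of_free _ _
  have : Finite (E ⊗[E[X]] A →ₐ[E] E) := inferInstance
  let F (φ : {φ : A →ₐ[E] E // φ (algebraMap E[X] A X) = 0}) : A →ₐ[E[X]] E :=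
    { φ.1.toRingHom with
      commutes' := fun p ↦ by
        have : φ.1.comp (IsScalarTower.toAlgHom E E[X] A) = Polynomial.aeval 0 :=
          Polynomial.algHom_ext (by simpa using φ.2)
        simpa [hX, aeval_def, eval₂_eq_eval_map] using congr($this p) }
  refine Finite.of_injective
    (fun φ ↦ (Algebra.TensorProduct.lift (.id E E) (F φ) fun _ _ ↦ .all _ _ :
      E ⊗[E[X]] A →ₐ[E] E)) fun φ ψ h ↦ ?_
  ext a
  simpa [F] using congr($h (1 ⊗ₜ a))

/-- Hensel's lemma: `ε` is a map to `E⟦X⟧ / (X)`, and formal smoothness lifts it to the `X`-adically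
complete ring `E⟦X⟧`. -/
theorem exists_algHom_powerSeries {E R : Type*} [Field E] [CommRing R]
    [Algebra E R] [Algebra E[X] R] [IsScalarTower E E[X] R] [Algebra.FormallySmooth E[X] R]
    (ε : R →ₐ[E] E) (hε : ε (algebraMap E[X] R X) = 0) :
    ∃ g : R →ₐ[E[X]] PowerSeries E, ∀ r, PowerSeries.constantCoeff (g r) = ε r := by
  let I : Ideal (PowerSeries E) := Ideal.span {PowerSeries.X}
  let f : R →ₐ[E[X]] PowerSeries E ⧸ I :=
    { (algebraMap E (PowerSeries E ⧸ I)).comp ε.toRingHom with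
      commutes' := fun p ↦ by
        have : ε.comp (IsScalarTower.toAlgHom E E[X] R) = Polynomial.aeval 0 :=
          Polynomial.algHom_ext (by simpa using hε)
        have h2 : ε (algebraMap E[X] R p) = p.coeff 0 := by
          simpa [aeval_def, eval₂_eq_eval_map, coeff_zero_eq_eval_zero] using congr($this p)
        change algebraMap E (PowerSeries E ⧸ I) (ε (algebraMap E[X] R p)) = _
        rw [h2, IsScalarTower.algebraMap_apply E (PowerSeries E) (PowerSeries E ⧸ I),
          IsScalarTower.algebraMap_apply E[X] (PowerSeries E) (PowerSeries E ⧸ I)]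
        refine Ideal.Quotient.eq.mpr ?_
        rw [Ideal.mem_span_singleton, PowerSeries.X_dvd_iff]
        simp [PowerSeries.algebraMap_apply'] }
  obtain ⟨g, hg⟩ := Algebra.FormallySmooth.exists_mkₐ_comp_eq_of_isAdicComplete f
  refine ⟨g, fun r ↦ ?_⟩
  have h : Ideal.Quotient.mk I (g r) = Ideal.Quotient.mk I (algebraMap E _ (ε r)) := congr($hg r)
  rw [Ideal.Quotient.eq, Ideal.mem_span_singleton, PowerSeries.X_dvd_iff, map_sub,
    sub_eq_zero] at h
  simpa using h

/-- A prime of an unramified `E[X]`-algebra over `X = 0` is generated by `X` locally. -/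
theorem Algebra.FormallyUnramified.maximalIdeal_eq_span_X {E R : Type*} [Field E] [CommRing R]
    [Algebra E[X] R] [Algebra.Etale E[X] R] (q : Ideal R) [q.IsPrime]
    (hq : algebraMap E[X] R X ∈ q) :
    IsLocalRing.maximalIdeal (Localization.AtPrime q) =
      Ideal.span {algebraMap E[X] (Localization.AtPrime q) X} := by
  have hp : (Ideal.span {X} : Ideal E[X]).IsMaximal :=
    PrincipalIdealRing.isMaximal_of_irreducible irreducible_X
  have : q.LiesOver (Ideal.span {X} : Ideal E[X]) := ⟨by
    refine hp.eq_of_le (Ideal.IsPrime.ne_top inferInstance) ?_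
    rwa [Ideal.span_singleton_le_iff_mem, Ideal.mem_comap]⟩
  let := Localization.AtPrime.algebraOfLiesOver (Ideal.span {X} : Ideal E[X]) q
  have h : Algebra.IsUnramifiedAt E[X] q := inferInstance
  rw [Algebra.isUnramifiedAt_iff_map_eq E[X] (Ideal.span {X}) q] at h
  rw [← h.2, Ideal.map_span, Set.image_singleton]

/-- In the local ring `Q` at the point, `X` generates the maximal ideal and maps to the
nonzerodivisor `X` of `E⟦X⟧`. An element killed in `E⟦X⟧` is therefore divisible by every power of
`X`, so it vanishes in `Q` by Krull's intersection theorem. -/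
theorem exists_mul_eq_zero_of_etale_of_map_eq_zero {E R : Type*} [Field E] [CommRing R]
    [Algebra E[X] R] [Algebra.Etale E[X] R]
    (g : R →ₐ[E[X]] PowerSeries E) {r : R} (hr : g r = 0) :
    ∃ s : R, PowerSeries.constantCoeff (g s) ≠ 0 ∧ s * r = 0 := by
  have : IsNoetherianRing R := Algebra.FiniteType.isNoetherianRing E[X] R
  let q : Ideal R := RingHom.ker ((PowerSeries.constantCoeff (R := E)).comp g.toRingHom)
  have hqm (a : R) : a ∈ q ↔ PowerSeries.constantCoeff (g a) = 0 := .rfl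
  have hq : q.IsPrime := RingHom.ker_isPrime _
  let Q := Localization.AtPrime q
  have hu (y : q.primeCompl) : IsUnit (g y) :=
    PowerSeries.isUnit_iff_constantCoeff.mpr (isUnit_iff_ne_zero.mpr y.2)
  let G : Q →ₐ[E[X]] PowerSeries E := IsLocalization.liftAlgHom (M := q.primeCompl) hu
  have hG (a : R) : G (algebraMap R Q a) = g a := by simp [G]
  have hXq : algebraMap E[X] R X ∈ q := by
    rw [hqm, AlgHom.commutes, PowerSeries.algebraMap_apply']
    simp
  have hmax : IsLocalRing.maximalIdeal Q = Ideal.span {algebraMap E[X] Q X} :=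
    Algebra.FormallyUnramified.maximalIdeal_eq_span_X q hXq
  have hGX : G (algebraMap E[X] Q X) = PowerSeries.X := by
    rw [AlgHom.commutes, PowerSeries.algebraMap_apply']
    simp
  have hmem (n : ℕ) : ∀ a : Q, G a = 0 → a ∈ IsLocalRing.maximalIdeal Q ^ n := by
    induction n with
    | zero => simp
    | succ n ih =>
      intro a ha
      have ha' : a ∈ IsLocalRing.maximalIdeal Q := fun h ↦ by
        simpa [ha] using h.map G
      rw [hmax, Ideal.mem_span_singleton'] at ha'
      obtain ⟨b, rfl⟩ := ha'
      rw [map_mul, hGX] at ha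
      have hb : G b = 0 := (mul_eq_zero.mp ha).resolve_right PowerSeries.X_ne_zero
      rw [pow_succ]
      exact Ideal.mul_mem_mul (ih b hb) (hmax ▸ Ideal.mem_span_singleton_self _)
  have hr0 : algebraMap R Q r ∈ ⨅ n, IsLocalRing.maximalIdeal Q ^ n :=
    (Submodule.mem_iInf _).mpr fun n ↦ hmem n _ ((hG r).trans hr)
  rw [Ideal.iInf_pow_eq_bot_of_isLocalRing _ (IsLocalRing.maximalIdeal.isMaximal Q).ne_top,
    Ideal.mem_bot, IsLocalization.map_eq_zero_iff q.primeCompl] at hr0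
  obtain ⟨s, hs⟩ := hr0
  exact ⟨s, s.2, hs⟩

/-- Inverting one `s` that kills the finitely generated kernel of `R → E⟦X⟧` isolates the component
through `ε`. The image also lives in the universe of `E`, as `IsAmple` requires. -/
theorem exists_subalgebra_powerSeries {E R : Type*} [Field E] [CommRing R]
    [Algebra E R] [Algebra E[X] R] [IsScalarTower E E[X] R] [Algebra.Etale E[X] R]
    (ε : R →ₐ[E] E) (hε : ε (algebraMap E[X] R X) = 0) :
    ∃ A : Subalgebra E[X] (PowerSeries E), Algebra.Etale E[X] A ∧ Nonempty (A →ₐ[E] E) ∧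
      Nonempty (R →ₐ[E[X]] A) := by
  obtain ⟨g, hg⟩ := exists_algHom_powerSeries ε hε
  have : IsNoetherianRing R := Algebra.FiniteType.isNoetherianRing E[X] R
  obtain ⟨T, hT⟩ := IsNoetherian.noetherian (RingHom.ker g)
  have hTg (t : T) : g t = 0 := by
    have : (t : R) ∈ RingHom.ker g := hT ▸ Ideal.subset_span t.2
    exact this
  choose c hc hc0 using fun t : T ↦ exists_mul_eq_zero_of_etale_of_map_eq_zero g (hTg t)
  let s := ∏ t, c t
  have hs : IsUnit (g s) := by
    rw [PowerSeries.isUnit_iff_constantCoeff, map_prod, map_prod, isUnit_iff_ne_zero]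
    exact Finset.prod_ne_zero_iff.mpr fun t _ ↦ hc t
  have hker : ∀ r, g r = 0 → s * r = 0 := by
    intro r hr
    have : RingHom.ker g ≤ LinearMap.ker (LinearMap.mulLeft R s) := by
      rw [← hT, Submodule.span_le]
      intro t ht
      obtain ⟨d, hd⟩ := Finset.dvd_prod_of_mem c (Finset.mem_univ ⟨t, ht⟩)
      change s * t = 0
      rw [show s = _ from hd, mul_right_comm, hc0 ⟨t, ht⟩, zero_mul]
    exact this hr
  have hu (y : Submonoid.powers s) : IsUnit (g y) := by
    obtain ⟨_, n, rfl⟩ := y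
    simpa using hs.pow n
  let G : Localization.Away s →ₐ[E[X]] PowerSeries E :=
    IsLocalization.liftAlgHom (M := Submonoid.powers s) hu
  have hG (a : R) : G (algebraMap R _ a) = g a := by simp [G]
  have hinj : Function.Injective G := by
    rw [injective_iff_map_eq_zero]
    intro x hx
    obtain ⟨r, y, rfl⟩ := IsLocalization.exists_mk'_eq (Submonoid.powers s) x
    have h := congr(G $(IsLocalization.mk'_spec (Localization.Away s) r y))
    rw [map_mul, hx, zero_mul, hG] at h
    rw [IsLocalization.mk'_eq_zero_iff]
    exact ⟨⟨s, Submonoid.mem_powers s⟩, hker r h.symm⟩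
  refine ⟨G.range, .of_equiv (AlgEquiv.ofInjective G hinj), ⟨?_⟩,
    ⟨G.rangeRestrict.comp (IsScalarTower.toAlgHom E[X] R (Localization.Away s))⟩⟩
  exact
    { (PowerSeries.constantCoeff (R := E)).comp G.range.val.toRingHom with
      commutes' := fun r ↦ by
        change PowerSeries.constantCoeff (algebraMap E (PowerSeries E) r) = r
        simp }

/-- Over an ample field, an étale `E[X]`-algebra with a rational point over `0` has a rational
point over some nonzero element. -/
theorem IsAmple.exists_algHom_ne_zero {E : Type u} [Field E] (hE : IsAmple E) {R : Type*}
    [CommRing R] [Algebra E R] [Algebra E[X] R] [IsScalarTower E E[X] R] [Algebra.Etale E[X] R]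
    (ε : R →ₐ[E] E) (hε : ε (algebraMap E[X] R X) = 0) :
    ∃ φ : R →ₐ[E] E, φ (algebraMap E[X] R X) ≠ 0 := by
  obtain ⟨A, _, _, ⟨ρ⟩⟩ := exists_subalgebra_powerSeries ε hε
  have : Infinite (A →ₐ[E] E) := hE.infinite_algHom A fun L _ _ ↦ A.isDomain_tensor_of_powerSeries L
  have hfin : Finite {φ : A →ₐ[E] E // φ (algebraMap E[X] A X) = 0} :=
    Algebra.Etale.finite_algHom_X_eq_zero
  obtain ⟨φ, hφ⟩ : ∃ φ : A →ₐ[E] E, φ (algebraMap E[X] A X) ≠ 0 := by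
    by_contra! h
    have : Finite (A →ₐ[E] E) := .of_injective (fun φ ↦ (⟨φ, h φ⟩ :
      {φ : A →ₐ[E] E // φ (algebraMap E[X] A X) = 0})) fun _ _ h ↦ congr($h.1)
    exact _root_.not_finite (A →ₐ[E] E)
  exact ⟨φ.comp (ρ.restrictScalars E), by simpa using hφ⟩

/-! ### Embedding étale `K[X]`-algebras into an ample field. -/

theorem Algebra.Etale.exists_pushout {P : Type u} {R : Type v} {S : Type w} [CommRing P]
    [CommRing R] [CommRing S] [Algebra P S] [Algebra.Etale P S] (h : P →+* R) :
    ∃ (R' : Type max v w) (_ : CommRing R') (_ : Algebra R R') (_ : Algebra.Etale R R')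
      (j : S →+* R'), (∀ p, j (algebraMap P S p) = algebraMap R R' (h p)) ∧
      ∀ {T : Type*} [CommRing T] (a : R →+* T) (b : S →+* T),
        (∀ p, a (h p) = b (algebraMap P S p)) →
        ∃ c : R' →+* T, (∀ r, c (algebraMap R R' r) = a r) ∧ ∀ s, c (j s) = b s := by
  algebraize [h]
  refine ⟨R ⊗[P] S, inferInstance, inferInstance, inferInstance,
    (Algebra.TensorProduct.includeRight (R := P) (A := R) (B := S)).toRingHom, fun p ↦ ?_,
    fun {T} _ a b hab ↦ ?_⟩
  · exact (Algebra.TensorProduct.includeRight (R := P) (A := R) (B := S)).commutes p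
  · let : Algebra P T := (a.comp h).toAlgebra
    let a' : R →ₐ[P] T := { a with commutes' := fun _ ↦ rfl }
    let b' : S →ₐ[P] T := { b with commutes' := fun p ↦ (hab p).symm }
    refine ⟨(Algebra.TensorProduct.lift a' b' fun _ _ ↦ .all _ _).toRingHom, fun r ↦ ?_, fun s ↦ ?_⟩
    · change Algebra.TensorProduct.lift a' b' _ (r ⊗ₜ 1) = _
      simp [a']
    · change Algebra.TensorProduct.lift a' b' _ (1 ⊗ₜ s) = _
      simp [b']

theorem IsAmple.exists_two_algHom {E : Type u} [Field E] (hE : IsAmple E) {K : Type v} [Field K]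
    [Algebra K E] {S : Type w} [CommRing S] [Algebra K S] [Algebra K[X] S] [IsScalarTower K K[X] S]
    [Algebra.Etale K[X] S] (ψ : S →ₐ[K] K) (hψ : ψ (algebraMap K[X] S X) = 0) (t : E) :
    ∃ α β : S →ₐ[K] E, α (algebraMap K[X] S X) ≠ 0 ∧
      β (algebraMap K[X] S X) = t * α (algebraMap K[X] S X) := by
  let h₁ : K[X] →+* E[X] := mapRingHom (algebraMap K E)
  obtain ⟨R₁, _, _, _, j₁, hj₁, hR₁⟩ := Algebra.Etale.exists_pushout (S := S) h₁
  -- `R₁` is the base change of `S` along `X ↦ X`, and `R₂` adjoins a second copy along `X ↦ t * X`.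
  -- Both substitutions fix the origin, so `ψ` used twice gives a point of `R₂` over `0`.
  let h₂ : K[X] →+* E[X] := eval₂RingHom (C.comp (algebraMap K E)) (C t * X)
  obtain ⟨R₂, _, _, _, j₂, hj₂, hR₂⟩ :=
    Algebra.Etale.exists_pushout (S := S) ((algebraMap E[X] R₁).comp h₂)
  algebraize [(algebraMap R₁ R₂).comp (algebraMap E[X] R₁), (algebraMap E[X] R₁).comp C,
    (algebraMap R₁ R₂).comp ((algebraMap E[X] R₁).comp C)]
  have : IsScalarTower E E[X] R₂ := .of_algebraMap_eq fun _ ↦ rfl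
  have : Algebra.Etale E[X] R₂ := .comp _ R₁ _
  have hψp (p : K[X]) : ψ (algebraMap K[X] S p) = p.eval 0 := by
    have : ψ.comp (IsScalarTower.toAlgHom K K[X] S) = Polynomial.aeval 0 :=
      Polynomial.algHom_ext (by simpa using hψ)
    simpa [aeval_def, eval₂_eq_eval_map] using congr($this p)
  obtain ⟨c₁, hc₁, -⟩ := hR₁ (evalRingHom (0 : E)) ((algebraMap K E).comp ψ.toRingHom) fun p ↦ by
    suffices (evalRingHom (0 : E)).comp h₁ = (algebraMap K E).comp (evalRingHom 0) by
      simpa [hψp] using congr($this p)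
    ext <;> simp [h₁]
  obtain ⟨c₂, hc₂, -⟩ := hR₂ c₁ ((algebraMap K E).comp ψ.toRingHom) fun p ↦ by
    suffices (evalRingHom (0 : E)).comp h₂ = (algebraMap K E).comp (evalRingHom 0) by
      simpa [hc₁, hψp] using congr($this p)
    ext <;> simp [h₂]
  let ε : R₂ →ₐ[E] E :=
    { c₂ with
      commutes' := fun r ↦ by
        change c₂ (algebraMap R₁ R₂ (algebraMap E[X] R₁ (C r))) = r
        simp [hc₁, hc₂] }
  have hε : ε (algebraMap E[X] R₂ X) = 0 := by
    change c₂ (algebraMap R₁ R₂ (algebraMap E[X] R₁ X)) = 0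
    simp [hc₁, hc₂]
  obtain ⟨φ, hφ⟩ := hE.exists_algHom_ne_zero ε hε
  have hφC (r : E) : φ (algebraMap R₁ R₂ (algebraMap E[X] R₁ (C r))) = r := φ.commutes r
  have hj₁C (k : K) : j₁ (algebraMap K S k) = algebraMap E[X] R₁ (C (algebraMap K E k)) := by
    rw [IsScalarTower.algebraMap_apply K K[X] S, hj₁]
    simp [h₁]
  have hj₂C (k : K) :
      j₂ (algebraMap K S k) = algebraMap R₁ R₂ (algebraMap E[X] R₁ (C (algebraMap K E k))) := by
    rw [IsScalarTower.algebraMap_apply K K[X] S, hj₂]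
    simp [h₂]
  let α : S →ₐ[K] E :=
    { (φ.toRingHom.comp (algebraMap R₁ R₂)).comp j₁ with
      commutes' := fun k ↦ by
        change φ (algebraMap R₁ R₂ (j₁ (algebraMap K S k))) = _
        rw [hj₁C, hφC] }
  let β : S →ₐ[K] E :=
    { φ.toRingHom.comp j₂ with
      commutes' := fun k ↦ by
        change φ (j₂ (algebraMap K S k)) = _
        rw [hj₂C, hφC] }
  have hα : α (algebraMap K[X] S X) = φ (algebraMap E[X] R₂ X) := by
    change φ (algebraMap R₁ R₂ (j₁ (algebraMap K[X] S X))) = _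
    rw [hj₁]
    simp [h₁]
    rfl
  refine ⟨α, β, hα ▸ hφ, ?_⟩
  rw [hα]
  change φ (j₂ (algebraMap K[X] S X)) = _
  rw [hj₂]
  simp only [h₂, RingHom.comp_apply, coe_eval₂RingHom, eval₂_X, map_mul, hφC]
  rfl

/-- A domain that is algebraic and étale over `K[X]`, with a `K`-point over `0`, embeds into every
ample extension of `K` of positive transcendence degree. -/
theorem IsAmple.exists_injective_algHom {E : Type u} [Field E] (hE : IsAmple E) {K : Type v}
    [Field K] [Algebra K E] (htr : 1 ≤ Algebra.trdeg K E) {S : Type w} [CommRing S] [IsDomain S]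
    [Algebra K S] [Algebra K[X] S] [IsScalarTower K K[X] S] [Algebra.Etale K[X] S]
    [Algebra.IsAlgebraic K[X] S]
    (ψ : S →ₐ[K] K) (hψ : ψ (algebraMap K[X] S X) = 0) :
    ∃ α : S →ₐ[K] E, Function.Injective α := by
  obtain ⟨t, ht⟩ : ∃ t : E, Transcendental K t := by
    have := trdeg_ne_zero_iff.mp (zero_lt_one.trans_le htr).ne'
    exact Algebra.Transcendental.transcendental
  obtain ⟨α, β, hα, hβ⟩ := hE.exists_two_algHom ψ hψ t
  have key (γ : S →ₐ[K] E) (hγ : Transcendental K (γ (algebraMap K[X] S X))) :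
      Function.Injective γ := by
    have hγp : (γ.comp (IsScalarTower.toAlgHom K K[X] S)) =
        Polynomial.aeval (γ (algebraMap K[X] S X)) := Polynomial.algHom_ext (by simp)
    have hinj : Function.Injective (γ.toRingHom.comp (algebraMap K[X] S)) := by
      have h := transcendental_iff_injective.mp hγ
      rwa [← hγp] at h
    rw [injective_iff_map_eq_zero]
    intro s hs
    by_contra h0
    obtain ⟨p, hp, hps⟩ := (Algebra.IsAlgebraic.isAlgebraic (R := K[X]) s).exists_nonzero_dvd
      (mem_nonZeroDivisors_of_ne_zero h0)
    obtain ⟨d, hd⟩ := hps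
    refine hp (hinj ?_)
    change γ (algebraMap K[X] S p) = γ (algebraMap K[X] S 0)
    rw [hd, map_mul, hs, zero_mul, map_zero, map_zero]
  by_cases h : Transcendental K (α (algebraMap K[X] S X))
  · exact ⟨α, key α h⟩
  -- If both coordinates were algebraic over `K`, so would be their quotient `t`.
  · refine ⟨β, key β (of_not_not fun hβ' ↦ ht ?_)⟩
    rw [Transcendental, not_not] at h
    have : t = β (algebraMap K[X] S X) * (α (algebraMap K[X] S X))⁻¹ := by
      rw [hβ, mul_inv_cancel_right₀ hα]
    exact this ▸ IsAlgebraic.mul (of_not_not hβ') h.inv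

/-! ### Valuations with residue field `K`: values of polynomials and discreteness. -/

theorem Valuation.sum_ne_zero_of_forall_lt {F Γ₀ ι : Type*} [Field F]
    [LinearOrderedCommGroupWithZero Γ₀] (v : Valuation F Γ₀) {s : Finset ι} {f : ι → F} {i : ι}
    (hi : i ∈ s) (h0 : f i ≠ 0) (h : ∀ j ∈ s, j ≠ i → v (f j) < v (f i)) : ∑ j ∈ s, f j ≠ 0 := by
  classical
  intro hs
  rw [← Finset.add_sum_erase s f hi, add_eq_zero_iff_eq_neg] at hs
  have hlt : v (∑ j ∈ s.erase i, f j) < v (f i) := v.map_sum_lt (v.ne_zero_iff.mpr h0)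
    fun j hj ↦ h j (Finset.mem_of_mem_erase hj) (Finset.ne_of_mem_erase hj)
  rw [hs, v.map_neg] at hlt
  exact hlt.false

/-- A valuation on an extension of `K` which is trivial on `K` and has residue field `K`. -/
structure Valuation.IsRationalOver (K : Type*) {F Γ₀ : Type*} [Field K] [Field F] [Algebra K F]
    [LinearOrderedCommGroupWithZero Γ₀] (v : Valuation F Γ₀) : Prop where
  map_algebraMap : ∀ a : K, a ≠ 0 → v (algebraMap K F a) = 1
  exists_sub_lt_one : ∀ x, v x ≤ 1 → ∃ a : K, v (x - algebraMap K F a) < 1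

namespace Valuation.IsRationalOver

variable {K F Γ₀ : Type*} [Field K] [Field F] [Algebra K F]
    [LinearOrderedCommGroupWithZero Γ₀] {v : Valuation F Γ₀} (hv : v.IsRationalOver K)
include hv

theorem map_algebraMap_le (a : K) : v (algebraMap K F a) ≤ 1 := by
  by_cases h : a = 0
  · simp [h]
  · exact (hv.map_algebraMap a h).le

theorem eq_zero_of_map_algebraMap_lt {a : K} (h : v (algebraMap K F a) < 1) : a = 0 := by
  by_contra h0
  exact h.ne (hv.map_algebraMap a h0)

theorem map_aeval_le {x : F} (hx : v x ≤ 1) (p : K[X]) : v (aeval x p) ≤ 1 := by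
  rw [aeval_eq_sum_range]
  refine v.map_sum_le fun i _ ↦ ?_
  rw [Algebra.smul_def, map_mul, map_pow]
  exact mul_le_one' (hv.map_algebraMap_le _) (pow_le_one' hx i)

theorem map_aeval {x : F} (hx : v x < 1) {p : K[X]} (hp : p ≠ 0) :
    v (aeval x p) = v x ^ p.natTrailingDegree := by
  obtain ⟨q, hq, hpq⟩ : ∃ q : K[X], q.coeff 0 ≠ 0 ∧ p = X ^ p.natTrailingDegree * q := by
    obtain ⟨q, hq⟩ : X ^ p.natTrailingDegree ∣ p :=
      X_pow_dvd_iff.mpr fun d hd ↦ coeff_eq_zero_of_lt_natTrailingDegree hd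
    refine ⟨q, fun h0 ↦ ?_, hq⟩
    have hn (n : ℕ) : (X ^ n * q).coeff n = q.coeff 0 := by simp [coeff_X_pow_mul']
    have : p.coeff p.natTrailingDegree = q.coeff 0 :=
      congr(coeff $hq p.natTrailingDegree).trans (hn _)
    rw [h0] at this
    exact trailingCoeff_nonzero_iff_nonzero.mpr hp this
  have h1 : v (aeval x q) = 1 := by
    rw [← hv.map_algebraMap _ hq, ← divX_mul_X_add q, map_add, aeval_C]
    simp only [coeff_add, mul_coeff_zero, coeff_X_zero, mul_zero, coeff_C_zero, zero_add]
    refine v.map_add_eq_of_lt_right ?_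
    rw [hv.map_algebraMap _ hq, map_mul, aeval_X, map_mul]
    exact (mul_le_of_le_one_left' (hv.map_aeval_le hx.le _)).trans_lt hx
  conv_lhs => rw [hpq]
  rw [map_mul, map_mul, h1, mul_one, map_pow, map_pow, aeval_X]

theorem transcendental {x : F} (hx : v x < 1) (hx0 : x ≠ 0) : Transcendental K x := by
  rintro ⟨p, hp, h⟩
  have := hv.map_aeval hx hp
  rw [h, map_zero] at this
  exact pow_ne_zero _ (v.ne_zero_iff.mpr hx0) this.symm

/-- Nonzero polynomials in `x` take values `v x ^ n`. Elements with distinct values in `(v x, 1]`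
are thus linearly independent over `K[X]`: the nonzero terms of a linear combination have distinct
values. Their number is at most `[F : k]`. -/
theorem finite_setOf_map {k : Type*} [Field k] [Algebra K[X] F] [IsScalarTower K K[X] F]
    [Algebra K[X] k] [IsFractionRing K[X] k] [Algebra k F] [IsScalarTower K[X] k F]
    [FiniteDimensional k F] (hx : v (algebraMap K[X] F X) < 1)
    (hx0 : algebraMap K[X] F X ≠ 0) :
    {γ | v (algebraMap K[X] F X) < γ ∧ γ ≤ 1 ∧ ∃ y, v y = γ}.Finite := by
  by_contra hinf
  set x := algebraMap K[X] F X with hxdef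
  have haev (p : K[X]) : algebraMap K[X] F p = aeval x p := by
    have : IsScalarTower.toAlgHom K K[X] F = aeval x := Polynomial.algHom_ext (by simp [x])
    exact congr($this p)
  have hvx0 : 0 < v x := by rwa [zero_lt_iff, v.ne_zero_iff]
  obtain ⟨T, hT, hcard⟩ := Set.Infinite.exists_subset_card_eq hinf (Module.finrank k F + 1)
  choose y hy using fun γ : T ↦ (hT γ.2).2.2
  have hli : LinearIndependent K[X] y := by
    classical
    rw [Fintype.linearIndependent_iff]
    by_contra! ⟨f, hf, hf0⟩
    let s := Finset.univ.filter fun i ↦ f i ≠ 0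
    have hval (i : T) (hi : f i ≠ 0) : v (f i • y i) = v x ^ (f i).natTrailingDegree * i := by
      rw [Algebra.smul_def, map_mul, haev, hv.map_aeval hx hi, hy]
    obtain ⟨i, hi, hmax⟩ := s.exists_max_image (fun i ↦ v (f i • y i))
      (hf0.imp fun i hi ↦ by simpa [s] using hi)
    have hi' : f i ≠ 0 := by simpa [s] using hi
    refine v.sum_ne_zero_of_forall_lt (s := s) (f := fun i ↦ f i • y i) hi ?_ ?_ ?_
    · rw [← v.ne_zero_iff, hval i hi']
      exact mul_ne_zero (pow_ne_zero _ hvx0.ne') (hvx0.trans (hT i.2).1).ne'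
    · intro j hj hji
      have hj' : f j ≠ 0 := by simpa [s] using hj
      refine lt_of_le_of_ne (hmax j hj) fun heq ↦ hji ?_
      rw [hval i hi', hval j hj'] at heq
      have key (a b : T) (m n : ℕ) (h : m < n) : v x ^ n * b < v x ^ m * a :=
        calc v x ^ n * b ≤ v x ^ n := mul_le_of_le_one_right' (hT b.2).2.1
          _ ≤ v x ^ (m + 1) := pow_le_pow_right_of_le_one' hx.le h
          _ = v x ^ m * v x := pow_succ _ _
          _ < v x ^ m * a := by
            have := pow_pos hvx0 m
            have := (hT a.2).1
            gcongr
      rcases lt_trichotomy (f i).natTrailingDegree (f j).natTrailingDegree with h | h | h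
      · exact absurd heq (key i j _ _ h).ne
      · rw [h] at heq
        exact Subtype.ext (mul_left_cancel₀ (pow_ne_zero _ hvx0.ne') heq)
      · exact absurd heq (key j i _ _ h).ne'
    · rw [Finset.sum_filter_of_ne, hf]
      exact fun i _ h h0 ↦ h (by rw [h0, zero_smul])
  have := (LinearIndependent.iff_fractionRing K[X] k).mp hli
  have := this.fintype_card_le_finrank
  rw [Fintype.card_coe, hcard] at this
  lia

end Valuation.IsRationalOver

/-! ### Separability of `F` over `K(π)`. -/

namespace Valuation.IsRationalOver

variable {K F Γ₀ : Type*} [Field K] [Field F] [Algebra K F]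
    [LinearOrderedCommGroupWithZero Γ₀] {v : Valuation F Γ₀} (hv : v.IsRationalOver K)
include hv

/-- If `b` is linearly independent over `K ^ p`, then `∑ b * c ^ p` is a unit as soon as
one of the `c` is. -/
theorem map_sum_mul_pow_eq_one (p : ℕ) [Fact p.Prime] [CharP K p] {B : Type*} {T : Finset B}
    {b : B → K} (hb : ∀ e : B → K, ∑ β ∈ T, b β * e β ^ p = 0 → ∀ β ∈ T, e β = 0)
    {c : B → F} (hc : ∀ β ∈ T, v (c β) ≤ 1) (hc1 : ∃ β ∈ T, v (c β) = 1) :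
    v (∑ β ∈ T, algebraMap K F (b β) * c β ^ p) = 1 := by
  have : CharP F p := charP_of_injective_algebraMap (algebraMap K F).injective p
  have hp : p ≠ 0 := (Fact.out : p.Prime).ne_zero
  refine le_antisymm (v.map_sum_le fun β hβ ↦ ?_) (not_lt.mp fun hlt ↦ ?_)
  · rw [map_mul, map_pow]
    exact mul_le_one' (hv.map_algebraMap_le _) (pow_le_one' (hc β hβ) p)
  · have hex (β : B) : ∃ a : K, β ∈ T → v (c β - algebraMap K F a) < 1 := by
      by_cases hβ : β ∈ T
      · exact (hv.exists_sub_lt_one _ (hc β hβ)).imp fun _ h _ ↦ h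
      · exact ⟨0, fun h ↦ absurd h hβ⟩
    choose e he using hex
    have h1 : v (∑ β ∈ T, algebraMap K F (b β) * (c β - algebraMap K F (e β)) ^ p) < 1 :=
      v.map_sum_lt one_ne_zero fun β hβ ↦ by
        rw [map_mul, map_pow]
        exact (mul_le_of_le_one_left' (hv.map_algebraMap_le _)).trans_lt
          (pow_lt_one₀ zero_le (he β hβ) hp)
    have h2 : algebraMap K F (∑ β ∈ T, b β * e β ^ p) =
        ∑ β ∈ T, algebraMap K F (b β) * c β ^ p -
          ∑ β ∈ T, algebraMap K F (b β) * (c β - algebraMap K F (e β)) ^ p := by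
      rw [← Finset.sum_sub_distrib, map_sum]
      refine Finset.sum_congr rfl fun β _ ↦ ?_
      rw [sub_pow_char, map_mul, map_pow]
      ring
    have h3 := hb e (hv.eq_zero_of_map_algebraMap_lt (h2 ▸ v.map_sub_lt hlt h1))
    obtain ⟨β, hβ, hβ1⟩ := hc1
    have := he β hβ
    rw [h3 β hβ, map_zero, sub_zero] at this
    exact this.ne hβ1

/-- After division by a coefficient of largest value, the least `j₀` for which some coefficient is a
unit gives a term of value `v π ^ j₀`, and this term strictly dominates all others. -/
theorem eq_zero_of_sum_mul_pow_eq_zero (p : ℕ) [Fact p.Prime] [CharP K p] {B : Type*}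
    {T : Finset B} {b : B → K}
    (hb : ∀ e : B → K, ∑ β ∈ T, b β * e β ^ p = 0 → ∀ β ∈ T, e β = 0)
    {π : F} (hπ0 : π ≠ 0) (hπ : v π < 1) (hmax : ∀ y, v y < 1 → v y ≤ v π) {d : ℕ → B → F}
    (hd : ∑ j ∈ Finset.range p, π ^ j * ∑ β ∈ T, algebraMap K F (b β) * d j β ^ p = 0) :
    ∀ j < p, ∀ β ∈ T, d j β = 0 := by
  have hp : p ≠ 0 := (Fact.out : p.Prime).ne_zero
  by_contra! ⟨j₁, hj₁, β₁, hβ₁, hne⟩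
  obtain ⟨⟨j₂, β₂⟩, hm, hle⟩ := (Finset.range p ×ˢ T).exists_max_image (fun i ↦ v (d i.1 i.2))
    ⟨(j₁, β₁), by simp [hj₁, hβ₁]⟩
  simp only [Finset.mem_product, Finset.mem_range] at hm hle
  have hd2 : d j₂ β₂ ≠ 0 := by
    rw [← v.ne_zero_iff, ← zero_lt_iff]
    exact (zero_lt_iff.mpr (v.ne_zero_iff.mpr hne)).trans_le (hle (j₁, β₁) ⟨hj₁, hβ₁⟩)
  let c (j : ℕ) (β : B) : F := d j β / d j₂ β₂
  have hc (j) (hj : j < p) (β) (hβ : β ∈ T) : v (c j β) ≤ 1 := by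
    rw [map_div₀]
    exact div_le_one_of_le₀ (hle (j, β) ⟨hj, hβ⟩) zero_le
  let s (j : ℕ) : F := ∑ β ∈ T, algebraMap K F (b β) * c j β ^ p
  have hs : ∑ j ∈ Finset.range p, π ^ j * s j = 0 := by
    have : ∑ j ∈ Finset.range p, π ^ j * s j = (∑ j ∈ Finset.range p,
        π ^ j * ∑ β ∈ T, algebraMap K F (b β) * d j β ^ p) / d j₂ β₂ ^ p := by
      simp only [s, c, div_pow, Finset.sum_div, Finset.mul_sum, mul_div_assoc]
    rw [this, hd, zero_div]
  classical
  have hex : ∃ j, j < p ∧ ∃ β ∈ T, v (c j β) = 1 :=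
    ⟨j₂, hm.1, β₂, hm.2, by simp only [c]; rw [div_self hd2, map_one]⟩
  set j₀ := Nat.find hex with hj₀
  obtain ⟨hj₀p, hβ₀⟩ := Nat.find_spec hex
  have hπ' : 0 < v π := zero_lt_iff.mpr (v.ne_zero_iff.mpr hπ0)
  have hsj₀ : v (π ^ j₀ * s j₀) = v π ^ j₀ := by
    rw [map_mul, map_pow, hv.map_sum_mul_pow_eq_one p hb (hc _ hj₀p) hβ₀, mul_one]
  refine v.sum_ne_zero_of_forall_lt (Finset.mem_range.mpr hj₀p) (f := fun j ↦ π ^ j * s j) ?_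
    (fun j hj hjne ↦ ?_) hs
  · rw [← v.ne_zero_iff, hsj₀]
    exact pow_ne_zero _ hπ'.ne'
  · rw [hsj₀, map_mul, map_pow]
    have hj := Finset.mem_range.mp hj
    rcases hjne.lt_or_gt with h | h
    -- For `j < j₀` every coefficient is a nonunit, so has value at most `v π` by `hmax`; its `p`-th
    -- power contributes at most `v π ^ p`, and `p > j₀`.
    · have hsj : v (s j) ≤ v π ^ p := v.map_sum_le fun β hβ ↦ by
        rw [map_mul, map_pow]
        refine (mul_le_of_le_one_left' (hv.map_algebraMap_le _)).trans ?_
        refine pow_le_pow_left₀ zero_le (hmax _ ((hc j hj β hβ).lt_of_ne fun h1 ↦ ?_)) p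
        exact Nat.find_min hex h ⟨hj, β, hβ, h1⟩
      calc v π ^ j * v (s j) ≤ v π ^ j * v π ^ p := by gcongr
        _ = v π ^ (j + p) := (pow_add _ _ _).symm
        _ < v π ^ j₀ := pow_lt_pow_right_of_lt_one₀ hπ' hπ (by lia)
    · have hsj : v (s j) ≤ 1 := v.map_sum_le fun β hβ ↦ by
        rw [map_mul, map_pow]
        exact mul_le_one' (hv.map_algebraMap_le _) (pow_le_one' (hc j hj β hβ) p)
      calc v π ^ j * v (s j) ≤ v π ^ j := mul_le_of_le_one_right' hsj
        _ < v π ^ j₀ := pow_lt_pow_right_of_lt_one₀ hπ' hπ h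

end Valuation.IsRationalOver

/-- A basis of `K` over `K ^ p`. -/
theorem exists_frobenius_basis (K : Type u) [Field K] (p : ℕ) [Fact p.Prime] [CharP K p] :
    ∃ (B : Type u) (b : B → K),
      (∀ (T : Finset B) (e : B → K), ∑ β ∈ T, b β * e β ^ p = 0 → ∀ β ∈ T, e β = 0) ∧
      ∀ a : K, ∃ (T : Finset B) (e : B → K), (∀ β ∉ T, e β = 0) ∧ a = ∑ β ∈ T, b β * e β ^ p := by
  let b := Module.Basis.ofVectorSpace (frobenius K p).fieldRange K
  have hp : p ≠ 0 := (Fact.out : p.Prime).ne_zero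
  refine ⟨_, b, fun T e h β hβ ↦ ?_, fun a ↦ ?_⟩
  · have h0 := linearIndependent_iff'.mp b.linearIndependent T
      (fun β ↦ ⟨e β ^ p, e β, frobenius_def p _⟩) (by
        rw [← h]
        exact Finset.sum_congr rfl fun β _ ↦ mul_comm _ _) β hβ
    exact eq_zero_of_pow_eq_zero congr(($h0 : K))
  · choose e he using fun β ↦ (b.repr a β).2
    simp only [frobenius_def] at he
    refine ⟨(b.repr a).support, e, fun β hβ ↦ ?_, ?_⟩
    · refine eq_zero_of_pow_eq_zero ((he β).trans ?_)
      rw [Finsupp.notMem_support_iff.mp hβ]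
      rfl
    · conv_lhs => rw [← b.linearCombination_repr a, Finsupp.linearCombination_apply, Finsupp.sum]
      exact Finset.sum_congr rfl fun β _ ↦ by rw [he, mul_comm]; rfl

/-- The products `X ^ j * b β` with `j < p` span `K[X]` over its `p`-th powers. Allowing any larger
`T'` lets several polynomials share one index set. -/
theorem Polynomial.exists_eq_sum_mul_pow {K B : Type*} [Field K] (p : ℕ) [Fact p.Prime]
    [CharP K p] {b : B → K}
    (hb : ∀ a : K, ∃ (T : Finset B) (e : B → K), (∀ β ∉ T, e β = 0) ∧ a = ∑ β ∈ T, b β * e β ^ p)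
    (c : K[X]) :
    ∃ (T : Finset B) (D : ℕ → B → K[X]), ∀ T', T ⊆ T' →
      c = ∑ j ∈ Finset.range p, X ^ j * ∑ β ∈ T', C (b β) * D j β ^ p := by
  classical
  have hp : p ≠ 0 := (Fact.out : p.Prime).ne_zero
  induction c using Polynomial.induction_on' with
  | add c c' h h' =>
    obtain ⟨T, D, h⟩ := h
    obtain ⟨T', D', h'⟩ := h'
    refine ⟨T ∪ T', fun j β ↦ D j β + D' j β, fun S hS ↦ ?_⟩
    conv_lhs => rw [h S (Finset.union_subset_left hS), h' S (Finset.union_subset_right hS)]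
    simp only [add_pow_char, mul_add, Finset.sum_add_distrib]
  | monomial n a =>
    obtain ⟨T, e, he, rfl⟩ := hb a
    refine ⟨T, fun j β ↦ if j = n % p then C (e β) * X ^ (n / p) else 0, fun T' hT' ↦ ?_⟩
    rw [Finset.sum_eq_single (n % p)]
    · have h (β : B) : X ^ (n % p) * (C (b β) * (C (e β) * X ^ (n / p)) ^ p) =
          monomial n (b β * e β ^ p) := by
        rw [← C_mul_X_pow_eq_monomial, C_mul, C_pow]
        conv_rhs => rw [← Nat.mod_add_div' n p, pow_add, pow_mul]
        ring
      simp only [if_true, Finset.mul_sum, h, ← map_sum]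
      congr 1
      exact Finset.sum_subset hT' fun β _ hβ ↦ by rw [he β hβ, zero_pow hp, mul_zero]
    · intro j _ hj
      simp [hj, hp]
    · intro h
      exact absurd (Finset.mem_range.mpr (Nat.mod_lt n (Nat.pos_of_ne_zero hp))) h

namespace Valuation.IsRationalOver

variable {K F Γ₀ : Type*} [Field K] [Field F] [Algebra K F]
    [LinearOrderedCommGroupWithZero Γ₀] {v : Valuation F Γ₀} (hv : v.IsRationalOver K)
    [Algebra K[X] F] [IsScalarTower K K[X] F] (hπ0 : algebraMap K[X] F X ≠ 0)
    (hπ : v (algebraMap K[X] F X) < 1)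
    (hmax : ∀ y, v y < 1 → v y ≤ v (algebraMap K[X] F X))
include hv hπ0 hπ hmax

/-- Writing each coefficient through `p`-th powers turns a relation among the `a i ^ p` into `∑ π ^
j * b β * (∑ i, D i j β • a i) ^ p = 0`. The inner sums then vanish, and independence of `a` kills
every `D i j β`. -/
theorem linearIndependent_pow (p : ℕ) [Fact p.Prime] [CharP K p] {ι : Type*} [Fintype ι]
    {a : ι → F} (ha : LinearIndependent K[X] a) :
    LinearIndependent K[X] fun i ↦ a i ^ p := by
  classical
  have : CharP F p := charP_of_injective_algebraMap (algebraMap K F).injective p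
  have hp : p ≠ 0 := (Fact.out : p.Prime).ne_zero
  rw [Fintype.linearIndependent_iff]
  intro c hc
  obtain ⟨B, b, hb, hb'⟩ := exists_frobenius_basis K p
  choose T D hD using fun i ↦ Polynomial.exists_eq_sum_mul_pow p hb' (c i)
  let S := Finset.univ.biUnion T
  have hD (i) := hD i S (Finset.subset_biUnion_of_mem T (Finset.mem_univ i))
  have h0 := hv.eq_zero_of_sum_mul_pow_eq_zero p (hb S) hπ0 hπ hmax
    (d := fun j β ↦ ∑ i, D i j β • a i) (by
      rw [← hc]
      have (i : ι) : c i • a i ^ p = ∑ j ∈ Finset.range p, algebraMap K[X] F X ^ j *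
          ∑ β ∈ S, algebraMap K F (b β) * (D i j β • a i) ^ p := by
        conv_lhs => rw [hD i, Algebra.smul_def, map_sum, Finset.sum_mul]
        refine Finset.sum_congr rfl fun j _ ↦ ?_
        rw [map_mul, map_pow, map_sum, mul_assoc, Finset.sum_mul]
        congr 1
        refine Finset.sum_congr rfl fun β _ ↦ ?_
        rw [map_mul, map_pow, Algebra.smul_def, mul_pow, mul_assoc,
          IsScalarTower.algebraMap_apply K K[X] F]
        rfl
      simp only [this]
      rw [Finset.sum_comm]
      refine Finset.sum_congr rfl fun j _ ↦ ?_
      rw [← Finset.mul_sum, Finset.sum_comm]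
      congr 1
      refine Finset.sum_congr rfl fun β _ ↦ ?_
      rw [← Finset.mul_sum, sum_pow_char])
  intro i
  rw [hD i]
  refine Finset.sum_eq_zero fun j hj ↦ mul_eq_zero_of_right _ (Finset.sum_eq_zero fun β hβ ↦ ?_)
  have := Fintype.linearIndependent_iff.mp ha _ (h0 j (Finset.mem_range.mp hj) β hβ) i
  rw [this, zero_pow hp, mul_zero]

/-- An inseparable minimal polynomial has the form `g(X ^ p)`. The powers of `y` below its degree
are independent, yet `g` is a relation among their `p`-th powers. -/
theorem isSeparable (k : Type*) [Field k]
    [Algebra K[X] k] [IsFractionRing K[X] k] [Algebra k F] [IsScalarTower K[X] k F]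
    [Algebra.IsAlgebraic k F] : Algebra.IsSeparable k F := by
  rcases CharP.exists' K with h | ⟨p, hp, h⟩
  · have : CharZero k := charZero_of_injective_algebraMap (IsFractionRing.injective K[X] k)
    infer_instance
  · have : CharP k p := charP_of_injective_algebraMap (IsFractionRing.injective K[X] k) p
    refine ⟨fun y ↦ ?_⟩
    have hy : IsIntegral k y := Algebra.IsIntegral.isIntegral y
    have hirr := minpoly.irreducible hy
    refine (separable_or p hirr).resolve_right fun ⟨_, g, hg, hgf⟩ ↦ hg.ne_zero ?_
    have hli := hv.linearIndependent_pow hπ0 hπ hmax p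
      ((LinearIndependent.iff_fractionRing K[X] k).mpr (_root_.linearIndependent_pow (K := k) y))
    rw [LinearIndependent.iff_fractionRing K[X] k, Fintype.linearIndependent_iff] at hli
    have hdeg : g.natDegree < (minpoly k y).natDegree := by
      rw [← hgf, natDegree_expand]
      exact lt_mul_of_one_lt_right hg.natDegree_pos hp.out.one_lt
    have h0 : ∑ i : Fin (minpoly k y).natDegree, g.coeff i • (y ^ (i : ℕ)) ^ p = 0 := by
      have := minpoly.aeval k y
      rw [← hgf, expand_aeval, aeval_eq_sum_range' hdeg, ← Fin.sum_univ_eq_sum_range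
        (fun i ↦ g.coeff i • (y ^ p) ^ i)] at this
      simpa only [← pow_mul, mul_comm] using this
    ext i
    by_cases hi : i < (minpoly k y).natDegree
    · exact hli (fun i ↦ g.coeff i) h0 ⟨i, hi⟩
    · exact coeff_eq_zero_of_natDegree_lt (hdeg.trans_le (not_lt.mp hi))

end Valuation.IsRationalOver

/-! ### An étale neighbourhood of the rational place. -/

namespace Valuation.IsRationalOver

variable {K F Γ₀ : Type*} [Field K] [Field F] [Algebra K F]
    [LinearOrderedCommGroupWithZero Γ₀] {v : Valuation F Γ₀} (hv : v.IsRationalOver K)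
include hv

/-- The residue in `K` of an element of value at most `1` is unique, and this uniqueness makes
reduction a `K`-algebra map. -/
theorem exists_residue {R : Type*} [CommRing R] [Algebra K R] (f : R →ₐ[K] F)
    (hf : ∀ r, v (f r) ≤ 1) :
    ∃ ψ : R →ₐ[K] K, ∀ r, v (f r - algebraMap K F (ψ r)) < 1 := by
  choose ψ hψ using fun r ↦ hv.exists_sub_lt_one (f r) (hf r)
  have huniq (r : R) (a : K) (ha : v (f r - algebraMap K F a) < 1) : ψ r = a := by
    rw [← sub_eq_zero]
    apply hv.eq_zero_of_map_algebraMap_lt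
    have := v.map_sub_lt ha (hψ r)
    rwa [sub_sub_sub_cancel_left, ← _root_.map_sub] at this
  refine ⟨
    { toFun := ψ
      map_one' := huniq _ _ ?_
      map_mul' := fun a b ↦ huniq _ _ ?_
      map_zero' := huniq _ _ ?_
      map_add' := fun a b ↦ huniq _ _ ?_
      commutes' := fun a ↦ huniq _ _ ?_ }, hψ⟩
  · simp
  · have h : f (a * b) - algebraMap K F (ψ a * ψ b) = f a * (f b - algebraMap K F (ψ b)) +
        algebraMap K F (ψ b) * (f a - algebraMap K F (ψ a)) := by
      simp only [map_mul]
      ring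
    rw [h]
    refine v.map_add_lt ?_ ?_ <;> rw [map_mul]
    · exact (mul_le_of_le_one_left' (hf a)).trans_lt (hψ b)
    · exact (mul_le_of_le_one_left' (hv.map_algebraMap_le _)).trans_lt (hψ a)
  · simp
  · have h : f (a + b) - algebraMap K F (ψ a + ψ b) = (f a - algebraMap K F (ψ a)) +
        (f b - algebraMap K F (ψ b)) := by
      simp only [map_add]
      ring
    exact h ▸ v.map_add_lt (hψ a) (hψ b)
  · simp

variable [Algebra K[X] F] [IsScalarTower K K[X] F]

theorem map_le_one_of_isIntegral (hx : v (algebraMap K[X] F X) ≤ 1) {y : F}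
    (hy : IsIntegral K[X] y) : v y ≤ 1 := by
  by_contra! h
  obtain ⟨f, hf, hfy⟩ := hy
  have hy0 : 0 < v y := zero_lt_one.trans h
  have haev (p : K[X]) : algebraMap K[X] F p = aeval (algebraMap K[X] F X) p := by
    have : IsScalarTower.toAlgHom K K[X] F = aeval (algebraMap K[X] F X) :=
      Polynomial.algHom_ext (by simp)
    exact congr($this p)
  rw [eval₂_eq_sum_range] at hfy
  refine v.sum_ne_zero_of_forall_lt (Finset.self_mem_range_succ f.natDegree)
    (f := fun i ↦ algebraMap K[X] F (f.coeff i) * y ^ i) ?_ (fun j hj hjn ↦ ?_) hfy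
  · rw [hf.coeff_natDegree, map_one, one_mul]
    exact pow_ne_zero _ (v.ne_zero_iff.mp hy0.ne')
  · have hj' : j < f.natDegree := by
      have := Finset.mem_range.mp hj
      lia
    simp only [hf.coeff_natDegree, map_one, one_mul, map_mul, map_pow]
    calc v (algebraMap K[X] F (f.coeff j)) * v y ^ j ≤ v y ^ j :=
          mul_le_of_le_one_left' (haev (f.coeff j) ▸ hv.map_aeval_le hx _)
      _ < v y ^ f.natDegree := pow_lt_pow_right₀ h hj'

/-- Let `q` be the ideal of elements of value `< 1` in the integral closure `B`. Its residue field
is `K` and `X` generates it locally, so `B` is unramified there; being torsion-free over `K[X]`, it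
is flat. Étaleness at `q` spreads to some `s ∉ q`, and the residue map extends to `B[1/s]`. -/
theorem exists_etale (hπ0 : algebraMap K[X] F X ≠ 0) (hπ : v (algebraMap K[X] F X) < 1)
    (hmax : ∀ y, v y < 1 → v y ≤ v (algebraMap K[X] F X))
    {k : Type*} [Field k] [Algebra K[X] k] [IsFractionRing K[X] k] [Algebra k F]
    [IsScalarTower K[X] k F] [FiniteDimensional k F] :
    ∃ s : integralClosure K[X] F, s ≠ 0 ∧ Algebra.Etale K[X] (Localization.Away s) ∧
      ∃ ψ : Localization.Away s →ₐ[K] K, ψ (algebraMap K[X] _ X) = 0 := by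
  let B := integralClosure K[X] F
  have : Algebra.IsSeparable k F := hv.isSeparable hπ0 hπ hmax k
  have hFin : Module.Finite K[X] B := IsIntegralClosure.finite K[X] k F B
  have hDed : IsDedekindDomain B := IsIntegralClosure.isDedekindDomain K[X] k F B
  have : FaithfulSMul K[X] F := by
    rw [faithfulSMul_iff_algebraMap_injective, IsScalarTower.algebraMap_eq K[X] k F]
    exact (algebraMap k F).injective.comp (IsFractionRing.injective K[X] k)
  have : Module.IsTorsionFree K[X] B := inferInstance
  have : Module.Flat K[X] B := inferInstance
  have : Algebra.FinitePresentation K[X] B :=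
    Algebra.FinitePresentation.of_finiteType.mp inferInstance
  have hB (b : B) : v (b : F) ≤ 1 := hv.map_le_one_of_isIntegral hπ.le b.2
  obtain ⟨ψ, hψ⟩ := hv.exists_residue (B.val.restrictScalars K) hB
  have hψ' (b : B) : ψ b = 0 ↔ v (b : F) < 1 := by
    refine ⟨fun h ↦ by simpa [h] using hψ b, fun h ↦ ?_⟩
    apply hv.eq_zero_of_map_algebraMap_lt
    simpa using v.map_sub_lt h (hψ b)
  let q : Ideal B := RingHom.ker ψ
  have hqm (b : B) : b ∈ q ↔ v (b : F) < 1 := hψ' b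
  have hψs : Function.Surjective ψ := fun a ↦ ⟨algebraMap K B a, by simp⟩
  have hq : q.IsMaximal := RingHom.ker_isMaximal_of_surjective ψ hψs
  have hXq : algebraMap K[X] B X ∈ q := (hqm _).mpr hπ
  have hp : (Ideal.span {X} : Ideal K[X]).IsMaximal :=
    PrincipalIdealRing.isMaximal_of_irreducible irreducible_X
  have : q.LiesOver (Ideal.span {X} : Ideal K[X]) := ⟨by
    refine hp.eq_of_le (Ideal.IsPrime.ne_top inferInstance) ?_
    rwa [Ideal.span_singleton_le_iff_mem, Ideal.mem_comap]⟩
  let := Localization.AtPrime.algebraOfLiesOver (Ideal.span {X} : Ideal K[X]) q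
  let Q := Localization.AtPrime q
  have hX0 : algebraMap K[X] B X ≠ 0 := fun h ↦ hπ0 congr(($h : F))
  have hDVR : IsDiscreteValuationRing Q :=
    IsLocalization.AtPrime.isDiscreteValuationRing_of_dedekind_domain B
      (P := q) (fun h ↦ hX0 (by rwa [h] at hXq)) Q
  have hunr : Algebra.IsUnramifiedAt K[X] q := by
    rw [Algebra.isUnramifiedAt_iff_map_eq K[X] (Ideal.span {X}) q]
    constructor
    · have hsurj : Function.Surjective (algebraMap (Ideal.span {X} : Ideal K[X]).ResidueField
          q.ResidueField) := by
        intro y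
        obtain ⟨b, rfl⟩ := Ideal.algebraMap_residueField_surjective q y
        refine ⟨algebraMap K[X] _ (C (ψ b)), ?_⟩
        rw [← IsScalarTower.algebraMap_apply, IsScalarTower.algebraMap_apply K[X] B, ← sub_eq_zero,
          ← _root_.map_sub, Ideal.algebraMap_residueField_eq_zero]
        change ψ _ = 0
        rw [_root_.map_sub, sub_eq_zero]
        exact (congrArg ψ (IsScalarTower.algebraMap_apply K K[X] B (ψ b)).symm).trans (ψ.commutes _)
      exact ⟨fun y ↦ by
        obtain ⟨a, rfl⟩ := hsurj y
        exact isSeparable_algebraMap a⟩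
    · rw [Ideal.map_span, Set.image_singleton]
      refine le_antisymm ?_ fun x hx ↦ ?_
      · rw [Ideal.span_singleton_le_iff_mem, IsScalarTower.algebraMap_apply K[X] B]
        exact (IsLocalization.AtPrime.to_map_mem_maximal_iff Q q _).mpr hXq
      · rw [Ideal.mem_span_singleton]
        have : ValuationRing Q := inferInstance
        have : PreValuationRing Q := this.toPreValuationRing
        -- In the discrete valuation ring `Q`, either `X` divides `x` or `X = x * c`. In the second
        -- case `c` must be a unit, since `v x ≤ v X` by maximality.
        rcases ValuationRing.dvd_total (algebraMap K[X] Q X) x with h | ⟨c, hc⟩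
        · exact h
        obtain ⟨a, s, rfl⟩ := IsLocalization.exists_mk'_eq q.primeCompl x
        obtain ⟨d, t, rfl⟩ := IsLocalization.exists_mk'_eq q.primeCompl c
        have ha : v (a : F) < 1 := (hqm a).mp
          ((IsLocalization.AtPrime.mk'_mem_maximal_iff Q q a s).mp hx)
        have hst (s : q.primeCompl) : v ((s : B) : F) = 1 :=
          (hB s).eq_of_not_lt fun h ↦ s.2 ((hqm _).mpr h)
        have heq : algebraMap K[X] B X * (s * t) = a * d := by
          apply IsLocalization.injective Q (Ideal.primeCompl_le_nonZeroDivisors q)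
          rw [map_mul, ← IsScalarTower.algebraMap_apply, hc, map_mul, map_mul,
            ← IsLocalization.mk'_spec Q a s, ← IsLocalization.mk'_spec Q d t]
          ring
        have hveq := congr(v ($heq : F))
        simp only [MulMemClass.coe_mul, map_mul, hst, mul_one] at hveq
        have hd : d ∉ q := fun hd ↦ by
          have hd := (hqm d).mp hd
          refine (?_ : v (algebraMap K[X] F X) < v (algebraMap K[X] F X)).false
          calc v (algebraMap K[X] F X) = v a * v d := hveq
            _ ≤ v (algebraMap K[X] F X) * v d := by gcongr; exact hmax _ ha
            _ < v (algebraMap K[X] F X) :=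
              mul_lt_of_lt_one_right (zero_lt_iff.mpr (v.ne_zero_iff.mpr hπ0)) hd
        obtain ⟨c', hc'⟩ := (IsLocalization.AtPrime.isUnit_mk'_iff Q q d t).mpr hd
        exact ⟨↑c'⁻¹, by rw [hc, ← hc', Units.mul_inv_cancel_right]⟩
  have : Algebra.IsEtaleAt K[X] q := Algebra.IsEtaleAt.of_isUnramifiedAt_of_flat q
  obtain ⟨s, hs, hsE⟩ := Algebra.exists_etale_of_isEtaleAt (R := K[X]) q
  refine ⟨s, fun h ↦ hs (h ▸ q.zero_mem), hsE, ?_⟩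
  have hu (y : Submonoid.powers s) : IsUnit (ψ y) := by
    obtain ⟨_, n, rfl⟩ := y
    simpa using (isUnit_iff_ne_zero.mpr hs : IsUnit (ψ s)).pow n
  refine ⟨IsLocalization.liftAlgHom (M := Submonoid.powers s) hu, ?_⟩
  rw [IsScalarTower.algebraMap_apply K[X] B]
  simpa using (hψ' _).mpr hπ

end Valuation.IsRationalOver

/-! ### Function fields of one variable and the conclusion. -/

theorem IsFunctionFieldOneVar.isAlgebraic {K : Type v} {F : Type w} [Field K] [Field F]
    [Algebra K F] (hF : IsFunctionFieldOneVar K F) [Algebra K[X] F] [IsScalarTower K K[X] F]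
    (hinj : Function.Injective (algebraMap K[X] F)) : Algebra.IsAlgebraic K[X] F := by
  have : FaithfulSMul K[X] F := (faithfulSMul_iff_algebraMap_injective K[X] F).mpr hinj
  have h := lift_trdeg_add_eq K K[X] F
  rw [Polynomial.trdeg_of_isDomain, hF.trdeg_eq_one, Cardinal.lift_one, Cardinal.lift_one] at h
  rw [← trdeg_eq_zero_iff]
  have h2 : (1 : Cardinal) + Cardinal.lift.{v} (Algebra.trdeg K[X] F) = 1 + 0 := by simpa using h
  rw [← Cardinal.lift_eq_zero.{v, w}]
  exact Cardinal.eq_of_add_eq_add_left h2 Cardinal.one_lt_aleph0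

theorem IsFunctionFieldOneVar.finiteDimensional {K : Type v} {F : Type w} [Field K] [Field F]
    [Algebra K F] (hF : IsFunctionFieldOneVar K F) [Algebra K[X] F] [IsScalarTower K K[X] F]
    [Algebra (FractionRing K[X]) F] [IsScalarTower K[X] (FractionRing K[X]) F] :
    FiniteDimensional (FractionRing K[X]) F := by
  have hinj : Function.Injective (algebraMap K[X] F) := by
    rw [IsScalarTower.algebraMap_eq K[X] (FractionRing K[X]) F]
    exact (algebraMap (FractionRing K[X]) F).injective.comp (IsFractionRing.injective _ _)
  have := hF.isAlgebraic hinj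
  have : Algebra.IsAlgebraic (FractionRing K[X]) F :=
    IsFractionRing.comap_isAlgebraic_iff (A := K[X]).mp this
  have : IsScalarTower K (FractionRing K[X]) F := .to₁₃₄ _ K[X] _ _
  have : Algebra.EssFiniteType K F := IntermediateField.fg_top_iff.mp hF.fg
  have : Algebra.EssFiniteType (FractionRing K[X]) F := .of_comp K _ _
  obtain ⟨s, hs⟩ := IntermediateField.fg_top (FractionRing K[X]) F
  have := IntermediateField.finiteDimensional_adjoin (K := FractionRing K[X]) (L := F)
    (S := (s : Set F)) fun x _ ↦ Algebra.IsIntegral.isIntegral x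
  rw [hs] at this
  exact IntermediateField.topEquiv.toLinearEquiv.finiteDimensional

theorem ValuationSubring.isRationalOver_valuation {K : Type v} {F : Type w} [Field K] [Field F]
    [Algebra K F] (O : ValuationSubring F) (h : ∀ a : K, algebraMap K F a ∈ O)
    (hO : Function.Surjective
      ((IsLocalRing.residue O).comp ((algebraMap K F).codRestrict O.toSubring h))) :
    O.valuation.IsRationalOver K where
  map_algebraMap a ha := by
    refine le_antisymm ((O.valuation_le_one_iff _).mpr (h a)) (not_lt.mp fun hlt ↦ ?_)
    have h1 := (O.valuation_le_one_iff _).mpr (h a⁻¹)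
    have h2 : O.valuation (algebraMap K F a) * O.valuation (algebraMap K F a⁻¹) = 1 := by
      rw [← map_mul, ← map_mul, mul_inv_cancel₀ ha, map_one, map_one]
    exact ((mul_le_of_le_one_right' h1).trans_lt hlt).ne h2
  exists_sub_lt_one x hx := by
    obtain ⟨a, ha⟩ := hO (IsLocalRing.residue O ⟨x, (O.valuation_le_one_iff x).mp hx⟩)
    refine ⟨a, ?_⟩
    have h0 : IsLocalRing.residue O (⟨x, (O.valuation_le_one_iff x).mp hx⟩ -
        (algebraMap K F).codRestrict O.toSubring h a) = 0 := by
      rw [map_sub, sub_eq_zero]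
      exact ha.symm
    rw [IsLocalRing.residue_eq_zero_iff] at h0
    exact (O.valuation_lt_one_iff _).mp h0

/-- If no nonzero element had value `< 1`, every element of `F` or its inverse would equal its
residue in `K`, against transcendence degree one. Starting from any `x ≠ 0` with `v x < 1`, only
finitely many values lie between `v x` and `1`, so a largest value below `1` exists. -/
theorem Valuation.IsRationalOver.exists_uniformizer {K : Type v} {F : Type w} [Field K] [Field F]
    [Algebra K F] (hF : IsFunctionFieldOneVar K F) {Γ₀ : Type*} [LinearOrderedCommGroupWithZero Γ₀]
    {v : Valuation F Γ₀} (hv : v.IsRationalOver K) :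
    ∃ π : F, π ≠ 0 ∧ v π < 1 ∧ ∀ y, v y < 1 → v y ≤ v π := by
  obtain ⟨x, hx0, hx⟩ : ∃ x : F, x ≠ 0 ∧ v x < 1 := by
    by_contra! h
    have halg : Algebra.IsAlgebraic K F := ⟨fun x ↦ by
      wlog hx : v x ≤ 1 generalizing x
      · have := this x⁻¹ (by rw [map_inv₀]; exact inv_le_one_of_one_le₀ (not_le.mp hx).le)
        exact IsAlgebraic.inv_iff.mp this
      obtain ⟨a, ha⟩ := hv.exists_sub_lt_one x hx
      have : x - algebraMap K F a = 0 := by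
        by_contra h0
        exact (h _ h0).not_gt ha
      rw [sub_eq_zero.mp this]
      exact isAlgebraic_algebraMap a⟩
    have := hF.trdeg_eq_one
    rw [trdeg_eq_zero_iff.mpr halg] at this
    exact zero_ne_one this
  have htr := hv.transcendental hx hx0
  algebraize [(aeval (R := K) x).toRingHom]
  have hX : algebraMap K[X] F X = x := aeval_X x
  have : IsScalarTower K K[X] F := .of_algebraMap_eq fun a ↦ (aeval_C x a).symm
  have : FaithfulSMul K[X] F := (faithfulSMul_iff_algebraMap_injective K[X] F).mpr
    (transcendental_iff_injective.mp htr)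
  let := FractionRing.liftAlgebra K[X] F
  have := FractionRing.isScalarTower_liftAlgebra K[X] F
  have := hF.finiteDimensional
  have hfin := hv.finite_setOf_map (k := FractionRing K[X]) (hX.symm ▸ hx) (hX.symm ▸ hx0)
  rw [hX] at hfin
  have hfin' : {γ | (v x < γ ∧ γ ≤ 1 ∧ ∃ y, v y = γ) ∧ γ < 1}.Finite := hfin.subset fun _ h ↦ h.1
  by_cases hne : {γ | (v x < γ ∧ γ ≤ 1 ∧ ∃ y, v y = γ) ∧ γ < 1}.Nonempty
  · obtain ⟨_, ⟨⟨h1, -, π, rfl⟩, h2⟩, hmax⟩ := hfin'.exists_maximalFor id _ hne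
    refine ⟨π, fun h ↦ by simp [h] at h1, h2, fun y hy ↦ ?_⟩
    by_contra! hlt
    exact (hmax ⟨⟨h1.trans hlt, hy.le, y, rfl⟩, hy⟩ hlt.le).not_gt hlt
  -- With no value strictly between `v x` and `1`, `x` is itself a uniformizer.
  · refine ⟨x, hx0, hx, fun y hy ↦ ?_⟩
    by_contra! hlt
    exact hne ⟨v y, ⟨hlt, hy.le, y, rfl⟩, hy⟩

theorem mainTheorem3 (E : Type u) [Field E] (hE : IsAmple E)
    (K : Type v) [Field K] [Algebra K E] (htr : 1 ≤ Algebra.trdeg K E)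
    (F : Type w) [Field F] [Algebra K F] (hF : IsFunctionFieldOneVar K F)
    (hplace : HasRationalPlace K F) :
    Nonempty (F →ₐ[K] E) := by
  obtain ⟨O, hO, hbij⟩ := hplace
  have hv := O.isRationalOver_valuation hO hbij.surjective
  obtain ⟨π, hπ0, hπ, hmax⟩ := hv.exists_uniformizer hF
  algebraize [(aeval (R := K) π).toRingHom]
  have hX : algebraMap K[X] F X = π := aeval_X π
  have : IsScalarTower K K[X] F := .of_algebraMap_eq fun a ↦ (aeval_C π a).symm
  have : FaithfulSMul K[X] F := (faithfulSMul_iff_algebraMap_injective K[X] F).mpr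
    (transcendental_iff_injective.mp (hv.transcendental hπ hπ0))
  let := FractionRing.liftAlgebra K[X] F
  have := FractionRing.isScalarTower_liftAlgebra K[X] F
  have := hF.finiteDimensional
  have halg := hF.isAlgebraic (FaithfulSMul.algebraMap_injective K[X] F)
  obtain ⟨s, hs, _, ψ, hψ⟩ := hv.exists_etale (k := FractionRing K[X]) (hX.symm ▸ hπ0)
    (hX.symm ▸ hπ) (hX.symm ▸ hmax)
  let B := integralClosure K[X] F
  have hle : Submonoid.powers s ≤ nonZeroDivisors B :=
    powers_le_nonZeroDivisors_of_noZeroDivisors hs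
  have : IsDomain (Localization.Away s) := IsLocalization.isDomain_localization hle
  have : Algebra.IsAlgebraic K[X] (Localization.Away s) :=
    have := IsLocalization.isAlgebraic (Localization.Away s) (Submonoid.powers s)
    have : Algebra.IsAlgebraic K[X] B := inferInstance
    .trans K[X] B _
  obtain ⟨α, hα⟩ := hE.exists_injective_algHom htr ψ hψ
  have hfrac : IsFractionRing B F :=
    integralClosure.isFractionRing_of_algebraic fun x hx ↦
      FaithfulSMul.algebraMap_injective K[X] F (hx.trans (map_zero _).symm)
  let β : B →ₐ[K] E := α.comp (IsScalarTower.toAlgHom K B (Localization.Away s))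
  exact ⟨IsFractionRing.liftAlgHom (K := F) (g := β)
    (hα.comp (IsLocalization.injective (Localization.Away s) hle))⟩
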